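/- A difference operator is a map $D:\mathbb{R}^{\mathbb{R}}\to\mathbb{R}^{\mathbb{R}}$ of the form $(Df)(x)=\sum_{i=1}^n a_i f(x+b_i)$ with real numbers $a_i,b_i$. A system of difference equations is a set $S$ of pairs $(D,g)$ with $D$ a difference operator and $g\in\mathbb{R}^{\mathbb{R}}$; a function $f:\mathbb{R}\to\mathbb{R}$ is a solution to $S$ if $Df=g$ for every $(D,g)\in S$. For $\mathcal{F}\subset\mathbb{R}^{\mathbb{R}}$, the solvability cardinal $\mathrm{sc}(\mathcal{F})$ is the least cardinal $\kappa$ such that every system of difference equations, all of whose subsystems of cardinality less than $\kappa$ have a solution in $\mathcal{F}$, itself has a solution in $\mathcal{F}$. Theorem. $\mathrm{sc}(\{f:\mathbb{R}\to\mathbb{R} : f \text{ is Borel}\})\ge\omega_2$. Moreover, the Continuum Hypothesis $2^{\omega}=\omega_1$ implies $\mathrm{sc}(\{f:\mathbb{R}\to\mathbb{R} : f \text{ is Borel}\})=\omega_2=(2^{\omega})^+$. -/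

import Mathlib

/-- `D : ℝ^ℝ → ℝ^ℝ` is a difference operator if it has the form
`(D f)(x) = ∑ i, a i * f (x + b i)` (a finite sum) with real `a i`, `b i`. -/
def IsDifferenceOperator (D : (ℝ → ℝ) → (ℝ → ℝ)) : Prop :=
  ∃ (n : ℕ) (a b : Fin n → ℝ), ∀ (f : ℝ → ℝ) (x : ℝ), D f x = ∑ i, a i * f (x + b i)

/-- The set of difference operators. -/
abbrev DifferenceOperator : Type :=
  {D : (ℝ → ℝ) → (ℝ → ℝ) // IsDifferenceOperator D}

/-- A system of difference equations `D f = g`: a set of pairs `(D, g)`. -/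
abbrev DifferenceSystem : Type :=
  Set (DifferenceOperator × (ℝ → ℝ))

/-- `f` is a solution to the system `S`. -/
def IsSolution (S : DifferenceSystem) (f : ℝ → ℝ) : Prop :=
  ∀ e ∈ S, e.1.val f = e.2

/-- The system `S` has a solution in the class `F`. -/
def SolvableIn (F : Set (ℝ → ℝ)) (S : DifferenceSystem) : Prop :=
  ∃ f ∈ F, IsSolution S f

/-- The property of `κ` that the solvability cardinal minimizes: a system all of whose subsystems
of size less than `κ` have a solution in `F` has itself a solution in `F`. -/
def HasSolvabilityProperty (F : Set (ℝ → ℝ)) (κ : Cardinal.{0}) : Prop :=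
  ∀ S : DifferenceSystem,
    (∀ S' : DifferenceSystem, S' ⊆ S → Cardinal.mk S' < κ → SolvableIn F S') → SolvableIn F S

/-- The solvability cardinal `sc(F)`: the least cardinal with the above property. (A set of
cardinals that is not empty contains its `sInf`.) -/
noncomputable def solvabilityCardinal (F : Set (ℝ → ℝ)) : Cardinal.{0} :=
  sInf {κ : Cardinal.{0} | HasSolvabilityProperty F κ}

/-- The class of Borel functions `ℝ → ℝ` (the measurable structure on `ℝ` is the Borel one). -/
def borelFunctions : Set (ℝ → ℝ) :=
  {f | Measurable f}

/-!
For a set `X ⊆ ℝ` and reals `h i`, indexed by the countable ordinals, consider the equations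
`f (x + h i) - f x = 1_X (x + h i) - 1_X x`. The set `X` and the reals `h i` are chosen such that
every countable set of these equations has a Borel solution while all of them together have none;
hence the solvability cardinal of the Borel functions exceeds `ℵ₁`.

Let `K ⊆ ℝ` be a Cantor set whose difference set `K - K` is null
(`volume_range_cantorFunction_sub`). Avoiding countably many null sets at each step of a transfinite
recursion gives reals `h i` of which no nontrivial integral combination lies in `K - K`
(`exists_linearCombination_notMem`). So a sum `k + ∑ j, l j * h j` with `k ∈ K` determines `k` and
the finitely supported integral vector `l`. Given Borel sets `E i ⊆ K`, let `X` consist of the sums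
with `l ≠ 0` and `k ∈ E i`, where `i` is the largest index with `l i ≠ 0`.

If `J` is a countable initial segment of the indices, then the sums with `l` supported in `J` form a
Borel part `X_J` of `X`. The rest of `X` is invariant under the translations by `h j`, `j ∈ J`,
because they change `l` only below its largest index. So the indicator of `X_J` solves the equations
with index in `J` (`indicator_sumsByLeadingIndex_difference`). On the other hand, for `k ∈ K` the
right-hand side of the `i`-th equation at `k` is `1` exactly if `k ∈ E i`. A Borel solution `f` of
all equations would therefore make each `E i` the section at `h i` of the Borel set
`{(b, k) | f (k + b) - f k = 1}`. The non-collapse of the Borel hierarchy, in the form of universal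
sets for its stages and a diagonal argument, yields Borel sets `E i` for which this is impossible
(`exists_borel_family_not_sections`).

For the upper bound, there are only `2 ^ ℵ₀` difference operators, and solvability of the
two-element subsystems leaves at most one right-hand side for each of them, so the whole system is
one of its subsystems of size less than `(2 ^ ℵ₀)⁺` (`hasSolvabilityProperty_succ_continuum`).
-/

open Set MeasureTheory MeasurableSpace Cardinal Pointwise

/-! ### Universal sets -/

/-- A family `F` of subsets of `X` is parametrizable if a single measurable set `U` in the product
of the Baire space `ℕ → ℕ` and `X` has every member of `F` among its sections. -/
def IsParametrizable {X : Type*} [MeasurableSpace X] (F : Set (Set X)) : Prop :=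
  ∃ U : Set ((ℕ → ℕ) × X), MeasurableSet U ∧ ∀ t ∈ F, ∃ y, t = {x | (y, x) ∈ U}

namespace IsParametrizable

variable {X : Type*} [MeasurableSpace X]

theorem mono {F G : Set (Set X)} (hG : IsParametrizable G) (h : F ⊆ G) : IsParametrizable F := by
  obtain ⟨U, hU, hs⟩ := hG
  exact ⟨U, hU, fun t ht => hs t (h ht)⟩

theorem singleton {t : Set X} (ht : MeasurableSet t) : IsParametrizable {t} :=
  ⟨{p | p.2 ∈ t}, measurable_snd ht, by rintro _ rfl; exact ⟨0, rfl⟩⟩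

theorem compl {F : Set (Set X)} (hF : IsParametrizable F) :
    IsParametrizable ((fun t => tᶜ) '' F) := by
  obtain ⟨U, hU, hs⟩ := hF
  refine ⟨Uᶜ, hU.compl, ?_⟩
  rintro _ ⟨t, ht, rfl⟩
  obtain ⟨y, rfl⟩ := hs t ht
  exact ⟨y, rfl⟩

/-- The first coordinate of the parameter selects the family. -/
theorem iUnion {F : ℕ → Set (Set X)} (hF : ∀ n, IsParametrizable (F n)) :
    IsParametrizable (⋃ n, F n) := by
  choose U hU hs using hF
  refine ⟨⋃ n, {p | p.1 0 = n ∧ ((fun k => p.1 (k + 1)), p.2) ∈ U n}, ?_, ?_⟩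
  · refine MeasurableSet.iUnion fun n => MeasurableSet.inter ?_ ?_
    · exact measurableSet_eq_fun (by fun_prop) measurable_const
    · have : Measurable fun p : (ℕ → ℕ) × X => ((fun k => p.1 (k + 1)), p.2) := by fun_prop
      exact this (hU n)
  · intro t ht
    obtain ⟨n, hn⟩ := mem_iUnion.1 ht
    obtain ⟨y, rfl⟩ := hs n t hn
    refine ⟨fun k => Nat.casesOn k n y, ?_⟩
    ext x
    simp

theorem biUnion {ι : Type*} {I : Set ι} (hI : I.Countable) {F : ι → Set (Set X)}
    (hF : ∀ i ∈ I, IsParametrizable (F i)) : IsParametrizable (⋃ i ∈ I, F i) := by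
  rcases I.eq_empty_or_nonempty with rfl | hne
  · exact (singleton MeasurableSet.empty).mono (by simp)
  · obtain ⟨e, rfl⟩ := hI.exists_eq_range hne
    rw [biUnion_range]
    exact iUnion fun n => hF _ (mem_range_self n)

theorem of_countable {F : Set (Set X)} (hc : F.Countable) (hF : ∀ t ∈ F, MeasurableSet t) :
    IsParametrizable F := by
  have := biUnion hc (F := fun t => {t}) fun t ht => singleton (hF t ht)
  simpa using this

theorem union {F G : Set (Set X)} (hF : IsParametrizable F) (hG : IsParametrizable G) :
    IsParametrizable (F ∪ G) :=
  (iUnion (F := fun n => Nat.casesOn n F fun _ => G) (by rintro (_ | _) <;> assumption)).mono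
    (union_subset (subset_iUnion_of_subset 0 subset_rfl) (subset_iUnion_of_subset 1 subset_rfl))

/-- A parameter in `ℕ → ℕ` codes a sequence of parameters through the pairing of `ℕ`. -/
theorem countable_unions {F : Set (Set X)} (hF : IsParametrizable F) :
    IsParametrizable (range fun f : ℕ → F => ⋃ n, (f n).1) := by
  obtain ⟨U, hU, hs⟩ := hF
  refine ⟨⋃ n, {p | ((fun k => p.1 (Nat.pair n k)), p.2) ∈ U}, ?_, ?_⟩
  · refine MeasurableSet.iUnion fun n => ?_
    have : Measurable fun p : (ℕ → ℕ) × X => ((fun k => p.1 (Nat.pair n k)), p.2) := by fun_prop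
    exact this hU
  · rintro _ ⟨f, rfl⟩
    choose y hy using fun n => hs (f n).1 (f n).2
    refine ⟨fun m => y m.unpair.1 m.unpair.2, ?_⟩
    ext x
    simp only [mem_iUnion, mem_ofPred_eq, Nat.unpair_pair]
    refine exists_congr fun n => ?_
    conv_lhs => rw [hy n]
    rfl

end IsParametrizable

theorem countable_Iio_of_lt_omega_one {i : Ordinal.{0}} (hi : i < Ordinal.omega 1) :
    (Iio i).Countable := by
  rw [← Cardinal.le_aleph0_iff_set_countable, Cardinal.mk_Iio_ordinal, Cardinal.lift_le_aleph0]
  rw [← Cardinal.ord_aleph, Cardinal.lt_ord] at hi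
  exact Order.lt_succ_iff.1 (by rwa [← Cardinal.aleph_zero, Cardinal.succ_aleph, zero_add])

/-- Each countable stage of the generation of a `σ`-algebra from a countable set is
parametrizable. -/
theorem isParametrizable_generateMeasurableRec {X : Type*} [MeasurableSpace X] {s : Set (Set X)}
    (hs : s.Countable) (hm : ∀ t ∈ s, MeasurableSet t) (i : Ordinal.{0})
    (hi : i < Ordinal.omega 1) :
    IsParametrizable (generateMeasurableRec s i) := by
  induction i using WellFoundedLT.induction with
  | _ i ih =>
    have hS : IsParametrizable (⋃ j < i, generateMeasurableRec s j) :=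
      .biUnion (countable_Iio_of_lt_omega_one hi) fun j hj => ih j hj (lt_trans hj hi)
    unfold generateMeasurableRec
    exact (((IsParametrizable.of_countable hs hm).union (.singleton .empty)).union hS.compl).union
      hS.countable_unions

/-- There are `ω₁` Borel subsets of an uncountable standard Borel space `C` that are not all
sections of one Borel set with parameters in a standard Borel space `Z`. The `i`-th set is the
diagonal set of a universal set for the `i`-th stage of the Borel hierarchy on `Z × C`; the
parameter of the universal set and the parameter in `Z` are both coded by the points of `C`. -/
theorem exists_borel_family_not_sections (C Z : Type*) [MeasurableSpace C] [StandardBorelSpace C]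
    [Uncountable C] [MeasurableSpace Z] [StandardBorelSpace Z] :
    ∃ E : Iio (Ordinal.omega.{0} 1) → Set C, (∀ i, MeasurableSet (E i)) ∧
      ∀ W : Set (Z × C), MeasurableSet W → ∃ i, ∀ z, E i ≠ {c | (z, c) ∈ W} := by
  set s := countableGeneratingSet (Z × C)
  have hU : ∀ i : Iio (Ordinal.omega.{0} 1), IsParametrizable (generateMeasurableRec s i) :=
    fun i => isParametrizable_generateMeasurableRec countable_countableGeneratingSet
      (fun t ht => measurableSet_countableGeneratingSet ht) i i.2
  choose U hU hs using hU
  have : Uncountable (ℕ → ℕ) := by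
    rw [← Cardinal.aleph0_lt_mk_iff]
    simpa using Cardinal.aleph0_lt_continuum
  rcases isEmpty_or_nonempty Z with hZ | hZ
  · exact ⟨fun _ => ∅, fun _ => .empty,
      fun W _ => ⟨⟨0, Ordinal.omega_pos 1⟩, fun z => isEmptyElim z⟩⟩
  -- The factor `ℕ → ℕ` makes the parameter space uncountable even if `Z` is countable.
  have : Uncountable ((ℕ → ℕ) × Z) := Prod.fst_surjective.uncountable
  let e : C ≃ᵐ (ℕ → ℕ) × Z := PolishSpace.measurableEquivOfNotCountable
    (not_countable_iff.2 inferInstance) (not_countable_iff.2 inferInstance)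
  refine ⟨fun i => {c | ((e c).1, ((e c).2, c)) ∉ U i}, fun i => ?_, fun W hW => ?_⟩
  · have : Measurable fun c => ((e c).1, ((e c).2, c)) := by fun_prop
    exact (this (hU i)).compl
  · have hW' : W ∈ generateMeasurableRec s (Ordinal.omega.{0} 1) := by
      rw [← generateMeasurable_eq_rec]
      rw [← generateFrom_countableGeneratingSet (α := Z × C)] at hW
      exact hW
    rw [generateMeasurableRec_omega_one, mem_iUnion₂] at hW'
    obtain ⟨i, hi, hWi⟩ := hW'
    refine ⟨⟨i, hi⟩, fun z hz => ?_⟩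
    obtain ⟨y, hy⟩ := hs ⟨i, hi⟩ W hWi
    have h1 := congrArg (e.symm (y, z) ∈ ·) hz
    rw [hy] at h1
    simp at h1

/-! ### A Cantor set with a null difference set -/

theorem continuous_cantorFunction {c : ℝ} (h1 : 0 ≤ c) (h2 : c < 1) :
    Continuous (cantorFunction c) := by
  refine continuous_tsum (u := fun n => c ^ n) (fun n => ?_)
    (summable_geometric_of_lt_one h1 h2) fun n f => ?_
  · have : (fun f : ℕ → Bool => cantorFunctionAux c f n)
        = (fun b : Bool => cond b (c ^ n) 0) ∘ fun f => f n := by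
      ext f; simp [cantorFunctionAux]
    rw [this]
    exact continuous_of_discreteTopology.comp (continuous_apply n)
  · rw [Real.norm_eq_abs, abs_of_nonneg (cantorFunctionAux_nonneg h1)]
    cases hf : f n
    · rw [cantorFunctionAux_false hf]; positivity
    · rw [cantorFunctionAux_true hf]

/-- If `K` is the range of `cantorFunction c`, then `K - K` is covered by three copies of itself
scaled by `c`, so it is null for `c < 1 / 3`. -/
theorem volume_range_cantorFunction_sub {c : ℝ} (h1 : 0 < c) (h2 : c < 1 / 3) :
    volume (range (cantorFunction c) - range (cantorFunction c)) = 0 := by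
  have hc : c < 1 := by linarith
  set K := range (cantorFunction c) with hK
  set D := K - K
  have hKc : IsCompact K := isCompact_range (continuous_cantorFunction h1.le hc)
  have hfin : volume D ≠ ⊤ := by
    have : IsCompact D := by
      simpa [D, sub_eq_add_neg] using hKc.add hKc.neg
    exact this.measure_lt_top.ne
  have hself : ∀ x ∈ K, ∃ e : ℝ, (e = 0 ∨ e = 1) ∧ ∃ y ∈ K, x = e + c * y := by
    rintro _ ⟨f, rfl⟩
    rw [cantorFunction_succ f h1.le hc]
    refine ⟨_, ?_, _, ⟨fun n => f (n + 1), rfl⟩, rfl⟩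
    cases f 0 <;> simp
  have hsub : D ⊆ ⋃ e ∈ ({-1, 0, 1} : Finset ℝ), (fun x => e + x) '' (c • D) := by
    rintro _ ⟨x, hx, y, hy, rfl⟩
    obtain ⟨e, he, x', hx', rfl⟩ := hself x hx
    obtain ⟨e', he', y', hy', rfl⟩ := hself y hy
    refine mem_iUnion₂.2 ⟨e - e', ?_, c • (x' - y'), smul_mem_smul_set (sub_mem_sub hx' hy'), ?_⟩
    · rcases he with rfl | rfl <;> rcases he' with rfl | rfl <;> norm_num
    · simp only [smul_eq_mul]; ring
  have hle : volume D ≤ 3 * (ENNReal.ofReal c * volume D) := by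
    calc volume D ≤ _ := measure_mono hsub
      _ ≤ ∑ e ∈ ({-1, 0, 1} : Finset ℝ), volume ((fun x => e + x) '' (c • D)) :=
        measure_biUnion_finset_le _ _
      _ = ∑ e ∈ ({-1, 0, 1} : Finset ℝ), ENNReal.ofReal c * volume D := by
        refine Finset.sum_congr rfl fun e _ => ?_
        rw [image_add_left, measure_preimage_add, Measure.addHaar_smul]
        simp [abs_of_pos h1]
      _ = _ := by
        rw [Finset.sum_const, nsmul_eq_mul]
        norm_num
  by_contra h0
  have hpos : 0 < (volume D).toReal := ENNReal.toReal_pos h0 hfin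
  have := ENNReal.toReal_mono (by finiteness) hle
  simp only [ENNReal.toReal_mul, ENNReal.toReal_ofReal h1.le, ENNReal.toReal_ofNat] at this
  nlinarith

/-! ### Translations independent modulo a null set -/

/-- Only countably many affine preimages of `D` have to be avoided. -/
theorem exists_forall_zsmul_add_notMem {D : Set ℝ} (hD : volume D = 0) {G : Set ℝ}
    (hG : G.Countable) : ∃ y : ℝ, ∀ n : ℤ, n ≠ 0 → ∀ g ∈ G, n * y + g ∉ D := by
  have hnull : volume (⋃ n ∈ {n : ℤ | n ≠ 0}, ⋃ g ∈ G, {y : ℝ | n * y + g ∈ D}) = 0 := by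
    refine (measure_biUnion_null_iff (to_countable _)).2 fun n hn => ?_
    refine (measure_biUnion_null_iff hG).2 fun g _ => ?_
    have : {y : ℝ | n * y + g ∈ D} = (fun y => (n : ℝ) * y) ⁻¹' ((fun x => x + g) ⁻¹' D) := rfl
    rw [this, Real.volume_preimage_mul_left (Int.cast_ne_zero.2 hn), measure_preimage_add_right,
      hD, mul_zero]
  have hne : (⋃ n ∈ {n : ℤ | n ≠ 0}, ⋃ g ∈ G, {y : ℝ | n * y + g ∈ D}) ≠ Set.univ := fun h => by
    rw [h, Real.volume_univ] at hnull
    exact ENNReal.top_ne_zero hnull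
  obtain ⟨y, hy⟩ := nonempty_compl.2 hne
  refine ⟨y, fun n hn g hg hmem => hy ?_⟩
  exact mem_iUnion₂.2 ⟨n, hn, mem_iUnion₂.2 ⟨g, hg, hmem⟩⟩

/-- For a null set `D` there are reals `h i`, indexed by a well-order with countable initial
segments, of which no nontrivial integral combination lies in `D`. They are chosen by recursion. -/
theorem exists_linearCombination_notMem {I : Type*} [LinearOrder I] [WellFoundedLT I]
    (hI : ∀ i : I, (Iio i).Countable) {D : Set ℝ} (hD : volume D = 0) :
    ∃ h : I → ℝ, ∀ l : I →₀ ℤ, l ≠ 0 → Finsupp.linearCombination ℤ h l ∉ D := by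
  let good (T : Set ℝ) (y : ℝ) : Prop := ∀ n : ℤ, n ≠ 0 → ∀ g ∈ Submodule.span ℤ T, n * y + g ∉ D
  have hgood : ∀ T : Set ℝ, T.Countable → ∃ y, good T y := fun T hT => by
    have : Countable T := hT
    have : (Submodule.span ℤ T : Set ℝ).Countable := by
      rw [← Subtype.range_coe (s := T), ← Finsupp.range_linearCombination, LinearMap.coe_range]
      exact countable_range _
    exact exists_forall_zsmul_add_notMem hD this
  let h : I → ℝ := (wellFounded_lt (α := I)).fix fun i f =>
    Classical.epsilon (good (range fun j : Iio i => f j j.2))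
  have hspec : ∀ i, good (h '' Iio i) (h i) := fun i => by
    have : h i = Classical.epsilon (good (h '' Iio i)) := by
      rw [image_eq_range]
      exact (wellFounded_lt (α := I)).fix_eq _ i
    rw [this]
    exact Classical.epsilon_spec (hgood _ ((hI i).image h))
  refine ⟨h, fun l hl => ?_⟩
  have hne : l.support.Nonempty := Finsupp.support_nonempty_iff.2 hl
  set i := l.support.max' hne
  have hi : l i ≠ 0 := Finsupp.mem_support_iff.1 (l.support.max'_mem hne)
  have hg : Finsupp.linearCombination ℤ h (l.erase i) ∈ Submodule.span ℤ (h '' Iio i) := by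
    rw [Finsupp.mem_span_image_iff_linearCombination]
    refine ⟨_, ?_, rfl⟩
    rw [Finsupp.mem_supported]
    intro j hj
    simp only [Finsupp.support_erase, Finset.coe_erase, mem_sdiff, Finset.mem_coe,
      mem_singleton_iff] at hj
    exact lt_of_le_of_ne (Finset.le_max' _ _ hj.1) hj.2
  have := hspec i (l i) hi _ hg
  rwa [← Finsupp.single_add_erase i l, map_add, Finsupp.linearCombination_single, zsmul_eq_mul]

/-! ### Sets of sums sorted by leading index -/

/-- `i` is the largest index at which `l` does not vanish. -/
def IsLeadingIndex {I : Type*} [LinearOrder I] (l : I →₀ ℤ) (i : I) : Prop :=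
  l i ≠ 0 ∧ ∀ j, i < j → l j = 0

/-- The set of the sums `k + ∑ j, l j * h j` where `l ∈ P` has a leading index `i` and `k` lies in
the set `B i` attached to this index. -/
def sumsByLeadingIndex {I : Type*} [LinearOrder I] (h : I → ℝ) (B : I → Set ℝ)
    (P : Set (I →₀ ℤ)) : Set ℝ :=
  ⋃ l ∈ P, ⋃ i ∈ {i | IsLeadingIndex l i}, (fun k => k + Finsupp.linearCombination ℤ h l) '' B i

theorem countable_setOf_support_subset {I : Type*} {J : Set I} (hJ : J.Countable) :
    {l : I →₀ ℤ | (l.support : Set I) ⊆ J}.Countable := by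
  have : Countable J := hJ
  have : Countable (Finsupp.supported ℤ ℤ J) :=
    (Finsupp.supportedEquivFinsupp J).injective.countable
  exact to_countable (Finsupp.supported ℤ ℤ J : Set (I →₀ ℤ))

section SumsByLeadingIndex

variable {I : Type*} [LinearOrder I] {h : I → ℝ} {B : I → Set ℝ}

theorem mem_sumsByLeadingIndex {P : Set (I →₀ ℤ)} {x : ℝ} :
    x ∈ sumsByLeadingIndex h B P ↔ ∃ l ∈ P, ∃ i, IsLeadingIndex l i ∧ ∃ k ∈ B i,
      k + Finsupp.linearCombination ℤ h l = x := by
  simp only [sumsByLeadingIndex, mem_iUnion₂, mem_image, exists_prop, mem_ofPred_eq]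

theorem IsLeadingIndex.unique {l : I →₀ ℤ} {i j : I} (hi : IsLeadingIndex l i)
    (hj : IsLeadingIndex l j) : i = j :=
  le_antisymm (not_lt.1 fun hlt => hi.1 (hj.2 _ hlt)) (not_lt.1 fun hlt => hj.1 (hi.2 _ hlt))

theorem isLeadingIndex_single (i : I) : IsLeadingIndex (Finsupp.single i 1) i :=
  ⟨by simp, fun j hj => by simp [hj.ne]⟩

theorem measurableSet_sumsByLeadingIndex (hB : ∀ i, MeasurableSet (B i)) {P : Set (I →₀ ℤ)}
    (hP : P.Countable) : MeasurableSet (sumsByLeadingIndex h B P) := by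
  refine .biUnion hP fun l _ => .biUnion ?_ fun i _ => ?_
  · exact Set.Subsingleton.countable fun i hi j hj => IsLeadingIndex.unique hi hj
  · exact (measurableEmbedding_addRight _).measurableSet_image.2 (hB i)

/-- Adding a multiple of `h j` does not change the leading index of a sum whose leading index is
above `j`. -/
theorem add_mem_sumsByLeadingIndex_compl {J : Set I} (hJ : IsLowerSet J) {j : I} (hj : j ∈ J)
    (n : ℤ) {x : ℝ} (hx : x ∈ sumsByLeadingIndex h B {l | (l.support : Set I) ⊆ J}ᶜ) :
    x + n * h j ∈ sumsByLeadingIndex h B {l | (l.support : Set I) ⊆ J}ᶜ := by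
  obtain ⟨l, hl, i, hi, k, hk, rfl⟩ := mem_sumsByLeadingIndex.1 hx
  have hiJ : i ∉ J := fun hiJ => hl fun a ha => by
    refine hJ (not_lt.1 fun hlt => ?_) hiJ
    exact Finsupp.mem_support_iff.1 ha (hi.2 a hlt)
  have hji : j < i := not_le.1 fun hle => hiJ (hJ hle hj)
  have hlead : IsLeadingIndex (l + Finsupp.single j n) i :=
    ⟨by simpa [hji.ne] using hi.1, fun a ha => by simp [hi.2 a ha, (hji.trans ha).ne]⟩
  refine mem_sumsByLeadingIndex.2 ⟨_, fun hs => hiJ (hs ?_), i, hlead, k, hk, ?_⟩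
  · exact Finsupp.mem_support_iff.2 hlead.1
  · simp [add_assoc]

/-- The set of all sums and its part with coefficients supported in the lower set `J` have
indicators that differ by an `h j`-periodic function, for each `j ∈ J`. -/
theorem indicator_sumsByLeadingIndex_difference
    (hinj : ∀ l l', ∀ i i', ∀ k ∈ B i, ∀ k' ∈ B i', k + Finsupp.linearCombination ℤ h l =
      k' + Finsupp.linearCombination ℤ h l' → l = l')
    {J : Set I} (hJ : IsLowerSet J) {j : I} (hj : j ∈ J) (x : ℝ) :
    (sumsByLeadingIndex h B univ).indicator (1 : ℝ → ℝ) (x + h j) -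
        (sumsByLeadingIndex h B univ).indicator 1 x =
      (sumsByLeadingIndex h B {l | (l.support : Set I) ⊆ J}).indicator 1 (x + h j) -
        (sumsByLeadingIndex h B {l | (l.support : Set I) ⊆ J}).indicator 1 x := by
  set P : Set (I →₀ ℤ) := {l | (l.support : Set I) ⊆ J}
  have hunion : sumsByLeadingIndex h B univ =
      sumsByLeadingIndex h B P ∪ sumsByLeadingIndex h B Pᶜ := by
    rw [← union_compl_self P]
    exact biUnion_union _ _ _
  have hdisj : Disjoint (sumsByLeadingIndex h B P) (sumsByLeadingIndex h B Pᶜ) := by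
    refine disjoint_left.2 fun x hx hx' => ?_
    obtain ⟨l, hl, i, -, k, hk, rfl⟩ := mem_sumsByLeadingIndex.1 hx
    obtain ⟨l', hl', i', -, k', hk', heq⟩ := mem_sumsByLeadingIndex.1 hx'
    exact hl' (hinj _ _ _ _ _ hk' _ hk heq ▸ hl)
  have hper : x + h j ∈ sumsByLeadingIndex h B Pᶜ ↔ x ∈ sumsByLeadingIndex h B Pᶜ := by
    constructor <;> intro hx
    · simpa using add_mem_sumsByLeadingIndex_compl hJ hj (-1) hx
    · simpa using add_mem_sumsByLeadingIndex_compl hJ hj 1 hx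
  have hind : (sumsByLeadingIndex h B Pᶜ).indicator (1 : ℝ → ℝ) (x + h j) =
      (sumsByLeadingIndex h B Pᶜ).indicator 1 x := by
    by_cases hx : x ∈ sumsByLeadingIndex h B Pᶜ
    · rw [indicator_of_mem hx, indicator_of_mem (hper.2 hx)]; rfl
    · rw [indicator_of_notMem hx, indicator_of_notMem (mt hper.1 hx)]
  rw [hunion, indicator_union_of_disjoint hdisj]
  simp only [hind]
  ring

end SumsByLeadingIndex

/-! ### An unsolvable system with solvable countable subsystems -/

/-- The difference operator `f ↦ f (x + b) - f x`. -/
def differenceBy (b : ℝ) : DifferenceOperator :=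
  ⟨fun f x => f (x + b) - f x, 2, ![1, -1], ![b, 0], fun f x => by simp [sub_eq_add_neg]⟩

/-- The equations are `f (x + h i) - f x = 1_X (x + h i) - 1_X x`, where `X` is the set of all sums
`k + ∑ j, l j * h j` with `k` in the `i`-th set `κ '' E i`, `i` being the leading index of `l`. For
`k` in the range of `κ` the `i`-th equation forces `f (k + h i) - f k` to be the indicator of
`κ '' E i`, so a Borel solution would make all the `E i` sections of one Borel set. -/
theorem exists_system_countably_solvable :
    ∃ S : DifferenceSystem, (∀ S' ⊆ S, S'.Countable → SolvableIn borelFunctions S') ∧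
      ¬ SolvableIn borelFunctions S := by
  let I := Iio (Ordinal.omega.{0} 1)
  let κ : (ℕ → Bool) → ℝ := cantorFunction (1 / 5)
  have hκc : Continuous κ := continuous_cantorFunction (by norm_num) (by norm_num)
  have hκi : Function.Injective κ := cantorFunction_injective (by norm_num) (by norm_num)
  have hκ : MeasurableEmbedding κ := (hκc.isClosedEmbedding hκi).measurableEmbedding
  have hI : ∀ i : I, (Iio i).Countable := fun i => by
    refine ((countable_Iio_of_lt_omega_one i.2).preimage Subtype.val_injective).mono ?_
    exact fun j hj => hj
  obtain ⟨h, hh⟩ := exists_linearCombination_notMem hI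
    (volume_range_cantorFunction_sub (c := 1 / 5) (by norm_num) (by norm_num))
  have : Uncountable (ℕ → Bool) := by
    rw [← Cardinal.aleph0_lt_mk_iff]
    simpa using Cardinal.aleph0_lt_continuum
  obtain ⟨E, hE, hEW⟩ := exists_borel_family_not_sections (ℕ → Bool) ℝ
  have hinj : ∀ l l', ∀ c c', κ c + Finsupp.linearCombination ℤ h l =
      κ c' + Finsupp.linearCombination ℤ h l' → l = l' := fun l l' c c' heq => by
    by_contra hne
    refine hh _ (sub_ne_zero.2 hne) ⟨κ c', mem_range_self _, κ c, mem_range_self _, ?_⟩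
    simp only [map_sub]
    linarith
  have hinjB : ∀ l l', ∀ i i', ∀ k ∈ κ '' E i, ∀ k' ∈ κ '' E i',
      k + Finsupp.linearCombination ℤ h l = k' + Finsupp.linearCombination ℤ h l' → l = l' := by
    rintro l l' i i' _ ⟨c, -, rfl⟩ _ ⟨c', -, rfl⟩
    exact hinj l l' c c'
  let X : Set ℝ := sumsByLeadingIndex h (fun i => κ '' E i) univ
  let e : I → DifferenceOperator × (ℝ → ℝ) := fun i =>
    (differenceBy (h i), fun x => X.indicator 1 (x + h i) - X.indicator 1 x)
  refine ⟨range e, fun S' hS' hc => ?_, ?_⟩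
  · have : Nonempty I := ⟨⟨0, Ordinal.omega_pos 1⟩⟩
    choose! s hs using fun p (hp : p ∈ S') => hS' hp
    -- Passing to the lower set generated by the indices that occur keeps it countable.
    let J : Set I := ⋃ p ∈ S', Iic (s p)
    have hJl : IsLowerSet J := isLowerSet_iUnion₂ fun p _ => isLowerSet_Iic _
    have hJc : J.Countable := hc.biUnion fun p _ => by
      rw [← Iio_insert]
      exact (hI _).insert _
    refine ⟨(sumsByLeadingIndex h (fun i => κ '' E i) {l | (l.support : Set I) ⊆ J}).indicator 1,
      measurable_const.indicator (measurableSet_sumsByLeadingIndex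
        (fun i => hκ.measurableSet_image.2 (hE i)) (countable_setOf_support_subset hJc)), ?_⟩
    intro p hp
    rw [← hs p hp]
    funext x
    exact (indicator_sumsByLeadingIndex_difference hinjB hJl (mem_biUnion hp self_mem_Iic) x).symm
  · rintro ⟨f, hf, hsol⟩
    have hf : Measurable f := hf
    -- The section of this Borel set at the parameter `h i` is `E i`.
    obtain ⟨i, hi⟩ := hEW {p | f (κ p.2 + p.1) - f (κ p.2) = 1}
      (measurableSet_eq_fun (by fun_prop) measurable_const)
    refine hi (h i) ?_
    ext c
    have hc : f (κ c + h i) - f (κ c) = X.indicator 1 (κ c + h i) - X.indicator 1 (κ c) :=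
      congrFun (hsol (e i) (mem_range_self i)) (κ c)
    have h0 : κ c ∉ X := fun hX => by
      obtain ⟨l, -, a, ha, _, ⟨c', -, rfl⟩, heq⟩ := mem_sumsByLeadingIndex.1 hX
      have : l = 0 := hinj l 0 c' c (by simpa using heq)
      exact ha.1 (by simp [this])
    have h1 : κ c + h i ∈ X ↔ c ∈ E i := by
      constructor
      · intro hX
        obtain ⟨l, -, a, ha, _, ⟨c', hc', rfl⟩, heq⟩ := mem_sumsByLeadingIndex.1 hX
        obtain rfl : l = Finsupp.single i 1 := hinj l _ c' c (by simpa using heq)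
        obtain rfl : a = i := ha.unique (isLeadingIndex_single i)
        obtain rfl : c' = c := hκi (by simpa using heq)
        exact hc'
      · intro hc'
        exact mem_sumsByLeadingIndex.2 ⟨Finsupp.single i 1, mem_univ _, i, isLeadingIndex_single i,
          κ c, mem_image_of_mem κ hc', by simp⟩
    change c ∈ E i ↔ f (κ c + h i) - f (κ c) = 1
    rw [hc, indicator_of_notMem h0, ← h1, sub_zero]
    by_cases hx : κ c + h i ∈ X <;> simp [hx]

/-! ### Bounds for the solvability cardinal -/

theorem HasSolvabilityProperty.mono {F : Set (ℝ → ℝ)} {κ μ : Cardinal.{0}}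
    (hκ : HasSolvabilityProperty F κ) (h : κ ≤ μ) : HasSolvabilityProperty F μ :=
  fun S hS => hκ S fun S' hS' hc => hS S' hS' (hc.trans_le h)

theorem mk_differenceOperator_le : #DifferenceOperator ≤ 𝔠 := by
  choose n a b hD using fun D : DifferenceOperator => D.2
  have hinj : Function.Injective
      fun D => (⟨n D, a D, b D⟩ : Σ n : ℕ, (Fin n → ℝ) × (Fin n → ℝ)) := by
    intro D D' heq
    have key : ∀ p q : Σ n : ℕ, (Fin n → ℝ) × (Fin n → ℝ), p = q → ∀ (f : ℝ → ℝ) (x : ℝ),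
        ∑ i, p.2.1 i * f (x + p.2.2 i) = ∑ i, q.2.1 i * f (x + q.2.2 i) := by
      rintro p _ rfl f x
      rfl
    refine Subtype.ext (funext fun f => funext fun x => ?_)
    rw [hD D, hD D']
    exact key _ _ heq f x
  refine (mk_le_of_injective hinj).trans ?_
  rw [mk_sigma]
  refine (sum_le_mk_mul_iSup _).trans ?_
  rw [mk_nat]
  refine mul_le_of_le aleph0_le_continuum aleph0_le_continuum (ciSup_le' fun n => ?_)
  simp only [mk_prod, mk_pi, prod_const, lift_id, mk_real, mk_fin]
  exact mul_le_of_le aleph0_le_continuum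
    (power_nat_le aleph0_le_continuum) (power_nat_le aleph0_le_continuum)

/-- If all two-element subsystems are solvable, then each operator occurs in the system with only
one right-hand side, so the system has at most `2 ^ ℵ₀` elements. -/
theorem hasSolvabilityProperty_succ_continuum (F : Set (ℝ → ℝ)) :
    HasSolvabilityProperty F (Order.succ 𝔠) := by
  intro S hS
  refine hS S subset_rfl (Order.lt_succ_iff.2 ?_)
  refine (mk_le_of_injective (f := fun e : S => e.1.1) ?_).trans mk_differenceOperator_le
  rintro ⟨e, he⟩ ⟨e', he'⟩ heq
  obtain ⟨f, -, hf⟩ := hS {e, e'} (pair_subset he he')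
    ((lt_aleph0_iff_set_finite.2 (toFinite _)).trans_le
      (aleph0_le_continuum.trans (Order.le_succ _)))
  have heq : e.1 = e'.1 := heq
  have h1 := hf e (by simp)
  have h2 := hf e' (by simp)
  exact Subtype.ext (Prod.ext heq (by rw [← h1, ← h2, heq]))

theorem not_hasSolvabilityProperty_aleph_one :
    ¬ HasSolvabilityProperty borelFunctions (aleph 1) := by
  obtain ⟨S, hS, hno⟩ := exists_system_countably_solvable
  refine fun h => hno (h S fun S' hS' hc => hS S' hS' ?_)
  rw [← le_aleph0_iff_set_countable, ← Order.lt_succ_iff, ← aleph_zero, succ_aleph, zero_add]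
  exact hc

theorem mainTheorem8 :
    Cardinal.aleph 2 ≤ solvabilityCardinal borelFunctions ∧
    ((2 : Cardinal.{0}) ^ Cardinal.aleph0.{0} = Cardinal.aleph 1 →
      solvabilityCardinal borelFunctions = Cardinal.aleph 2 ∧
      Cardinal.aleph 2 = Order.succ ((2 : Cardinal.{0}) ^ Cardinal.aleph0.{0})) := by
  have h2 : aleph 2 = Order.succ (aleph 1) := by
    rw [succ_aleph, one_add_one_eq_two]
  have hlow : aleph 2 ≤ solvabilityCardinal borelFunctions := by
    refine le_csInf ⟨_, hasSolvabilityProperty_succ_continuum _⟩ fun κ hκ => ?_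
    rw [h2, Order.succ_le_iff, ← not_le]
    exact fun hle => not_hasSolvabilityProperty_aleph_one (HasSolvabilityProperty.mono hκ hle)
  refine ⟨hlow, fun hCH => ?_⟩
  have hsucc : aleph 2 = Order.succ ((2 : Cardinal.{0}) ^ Cardinal.aleph0.{0}) := by
    rw [hCH, h2]
  refine ⟨le_antisymm (csInf_le' ?_) hlow, hsucc⟩
  rw [hsucc, two_power_aleph0]
  exact hasSolvabilityProperty_succ_continuum _
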